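/- **Bifurcation Logic (BL).** Formulae are built from propositional letters by $\neg$, $\wedge$, $\Box$, $\ast$ and $-\!\ast$; as usual $A\vee B=\neg(\neg A\wedge\neg B)$, $\Diamond A=\neg\Box\neg A$, and $\top=A\vee\neg A$ for any formula $A$. In a partial order, two elements are *separated*, $a\perp b$, if neither $a\le b$ nor $b\le a$. A *tree* is a partial order that has a least element (the root) and in which $a\perp b$ and $a\le a'$ imply $a'\perp b$. A *model* is a tree of worlds $W$ with a valuation assigning to each world a set of propositional letters. Truth at a world $w$ is defined as usual for letters, $\neg$ and $\wedge$; $w\Vdash\Box A$ iff $w'\Vdash A$ for all $w'\ge w$; $w\Vdash A\ast B$ iff there are $w_1,w_2\ge w$ with $w_1\perp w_2$, $w_1\Vdash A$ and $w_2\Vdash B$; $w\Vdash A -\!\ast B$ iff for all $w_1,w_2$ with $w_2\le w$, $w_2\le w_1$ and $w\perp w_1$: if $w_1\Vdash A$ then $w_2\Vdash B$. A formula is *satisfied in a model* if it is true at all its worlds, and *satisfiable* if it is satisfied in some model. A *finite model with backlinks* is a finite tree with a valuation, together with a finite family of *backlinks*, i.e. additional edges from a node $s$ to a node $t\le s$ (loops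 and parallel edges are allowed). Its *unfolding* is the (possibly infinite) BL model whose worlds are the finite walks from the root along edges of the tree (from a node to an immediate successor) and backlinks, ordered by extension, each walk carrying the valuation of its last node. A formula is satisfied in the model with backlinks if it is satisfied in the unfolding. **Statement.** 1. If a $-\!\ast$-free formula $\varphi$ is satisfiable in BL, then there is a finite model with backlinks in which $\varphi$ is satisfied (so $\varphi$ is true at every world of its unfolding). 2. If a $-\!\ast$-free formula $\varphi$ is true at some world of a model in which every world has only finitely many predecessors, then there is a finite model with backlinks such that $\varphi$ is true at the root of its unfolding. 3. The ordinary finite model property fails: $\Box(\top\ast\top)$ is satisfiable, but it is true at no world of any finite model. -/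

import Mathlib

universe u v

namespace BL

/-- Formulas of Bifurcation Logic over a set `Atom` of propositional letters. -/
inductive Formula (Atom : Type v) : Type v
  | atom : Atom → Formula Atom
  | neg : Formula Atom → Formula Atom
  | and : Formula Atom → Formula Atom → Formula Atom
  | box : Formula Atom → Formula Atom
  | star : Formula Atom → Formula Atom → Formula Atom
  | wand : Formula Atom → Formula Atom → Formula Atom

namespace Formula

variable {Atom : Type v}

/-- `A ∨ B`, defined as `¬(¬A ∧ ¬B)`. -/
def or (A B : Formula Atom) : Formula Atom := neg (and (neg A) (neg B))

/-- `⊤`, defined as `A ∨ ¬A`. -/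
def top (A : Formula Atom) : Formula Atom := or A (neg A)

/-- The magic wand does not occur in the formula. -/
def WandFree : Formula Atom → Prop
  | atom _ => True
  | neg A => A.WandFree
  | and A B => A.WandFree ∧ B.WandFree
  | box A => A.WandFree
  | star A B => A.WandFree ∧ B.WandFree
  | wand _ _ => False

end Formula

/-- Two elements of a partial order are separated if they are incomparable. -/
def Separated {W : Type u} [PartialOrder W] (a b : W) : Prop := ¬ a ≤ b ∧ ¬ b ≤ a

/-- A tree: a rooted partial order with the persistent separation property. -/
structure IsTree (W : Type u) [PartialOrder W] : Prop where
  rooted : ∃ r : W, ∀ w : W, r ≤ w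
  persistent : ∀ a b a' : W, Separated a b → a ≤ a' → Separated a' b

/-- The ternary bifurcation relation: `b` and `c` belong to distinct futures of `a`. -/
def Bifurcates {W : Type u} [PartialOrder W] (a b c : W) : Prop :=
  a ≤ b ∧ a ≤ c ∧ Separated b c

/-- A model: a tree of worlds together with a valuation. -/
structure Model (Atom : Type v) : Type (max (u + 1) v) where
  World : Type u
  order : PartialOrder World
  isTree : IsTree World
  val : World → Set Atom

attribute [instance] Model.order

namespace Model

variable {Atom : Type v}

/-- Truth of a formula at a world of a model. -/
def Holds (M : Model.{u, v} Atom) : M.World → Formula Atom → Prop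
  | w, .atom p => p ∈ M.val w
  | w, .neg A => ¬ M.Holds w A
  | w, .and A B => M.Holds w A ∧ M.Holds w B
  | w, .box A => ∀ w', w ≤ w' → M.Holds w' A
  | w, .star A B => ∃ w₁ w₂, Bifurcates w w₁ w₂ ∧ M.Holds w₁ A ∧ M.Holds w₂ B
  | w, .wand A B => ∀ w₁ w₂, Bifurcates w₂ w w₁ → M.Holds w₁ A → M.Holds w₂ B

/-- A formula is satisfied in a model if it holds at every world. -/
def Satisfies (M : Model.{u, v} Atom) (A : Formula Atom) : Prop := ∀ w, M.Holds w A

/-- Every world is at finite height: it has only finitely many predecessors. -/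
def FiniteHeights (M : Model.{u, v} Atom) : Prop := ∀ w : M.World, (Set.Iic w).Finite

end Model

/-- A formula is satisfiable if it is satisfied in some model (with worlds in `Type u`). -/
def Satisfiable {Atom : Type v} (A : Formula Atom) : Prop :=
  ∃ M : Model.{u, v} Atom, M.Satisfies A

/-- A finite model with backlinks: a finite tree with a valuation, together with finitely many
backlinks, which are edges pointing backward in the tree order. There may be several backlinks
with the same two ends, and a backlink may be a loop. -/
structure BacklinkModel (Atom : Type v) : Type (max 1 v) where
  Node : Type
  order : PartialOrder Node
  finiteNode : Finite Node
  isTree : IsTree Node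
  Link : Type
  finiteLink : Finite Link
  linkSrc : Link → Node
  linkTgt : Link → Node
  backward : ∀ b, linkTgt b ≤ linkSrc b
  val : Node → Set Atom

attribute [instance] BacklinkModel.order BacklinkModel.finiteNode BacklinkModel.finiteLink

namespace BacklinkModel

variable {Atom : Type v}

/-- The root of the underlying finite tree. -/
noncomputable def root (N : BacklinkModel.{v} Atom) : N.Node := N.isTree.rooted.choose

theorem root_le (N : BacklinkModel.{v} Atom) (n : N.Node) : N.root ≤ n :=
  N.isTree.rooted.choose_spec n

/-- An edge is either a tree edge, from a node to an immediate successor, or a backlink. -/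
inductive Edge (N : BacklinkModel.{v} Atom) : Type
  | tree (a b : N.Node) (h : a ⋖ b) : Edge N
  | link (l : N.Link) : Edge N

/-- The node at which an edge starts. -/
def Edge.src {N : BacklinkModel.{v} Atom} : N.Edge → N.Node
  | .tree a _ _ => a
  | .link l => N.linkSrc l

/-- The node at which an edge ends. -/
def Edge.tgt {N : BacklinkModel.{v} Atom} : N.Edge → N.Node
  | .tree _ b _ => b
  | .link l => N.linkTgt l

/-- A list of edges that forms a walk starting at the node `n`. -/
def IsWalk (N : BacklinkModel.{v} Atom) : N.Node → List N.Edge → Prop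
  | _, [] => True
  | n, e :: l => e.src = n ∧ N.IsWalk e.tgt l

/-- The last node of a walk that starts at the node `n`. -/
def walkEnd (N : BacklinkModel.{v} Atom) : N.Node → List N.Edge → N.Node
  | n, [] => n
  | _, e :: l => N.walkEnd e.tgt l

/-- The worlds of the unfolding are the finite walks that start at the root. -/
def UnfoldedWorld (N : BacklinkModel.{v} Atom) : Type := {l : List N.Edge // N.IsWalk N.root l}

/-- Walks are ordered by extension. -/
instance (N : BacklinkModel.{v} Atom) : PartialOrder N.UnfoldedWorld where
  le x y := x.1 <+: y.1
  le_refl x := List.prefix_refl x.1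
  le_trans _ _ _ h₁ h₂ := List.IsPrefix.trans h₁ h₂
  le_antisymm _ _ h₁ h₂ := Subtype.ext (h₁.eq_of_length (le_antisymm h₁.length_le h₂.length_le))

/-- The root of the unfolding is the empty walk. -/
def unfoldedRoot (N : BacklinkModel.{v} Atom) : N.UnfoldedWorld := ⟨[], trivial⟩

theorem unfoldedWorld_isTree (N : BacklinkModel.{v} Atom) : IsTree N.UnfoldedWorld where
  rooted := ⟨N.unfoldedRoot, fun w => List.nil_prefix (l := w.1)⟩
  persistent a b _ h haa' :=
    ⟨fun h' => h.1 (le_trans haa' h'), fun h' =>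
      (List.prefix_or_prefix_of_prefix (l₁ := a.1) (l₂ := b.1) haa' h').elim h.1 h.2⟩

/-- The unfolding: the model whose worlds are the walks from the root, each of them carrying the
valuation of its last node. -/
noncomputable def unfolding (N : BacklinkModel.{v} Atom) : Model.{0, v} Atom where
  World := N.UnfoldedWorld
  order := inferInstance
  isTree := N.unfoldedWorld_isTree
  val w := N.val (N.walkEnd N.root w.1)

end BacklinkModel

end BL

/-! A `-∗`-free formula looks only upwards. For a property `i` ("this subformula is true" or "it is
false"), record at a world whether `i` holds there, whether it holds somewhere above (`Dia`), and
whether `i` and `j` hold at separated worlds above (`Bif`). This is the `signature`. There are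
finitely many signatures, and `Dia` and `Bif` can only shrink on the way up. Falsity of `□A` is a
`Dia` and truth of `A ∗ B` is a `Bif`.

A fragment above `w` is a finite set of worlds that meets all `Dia` and `Bif` obligations of `w`.
Its points that are not maximal meet their own obligations or pass them upwards. With one fragment
for each representative of a signature, every maximal point is identified with the root of the
fragment of its representative. The pending obligations are met there, and the result is a finite
multigraph (`FragmentSystem.nonempty_realization`). Its tree of simple paths, with backlinks for
edges to visited vertices, has the same walks (`exists_backlinkModel_cover`). In the unfolding a
walk satisfies the same subformulas as the point at its end (`holds_unfolding_iff`).

It remains to find fragments. For statement 1, pass to the worlds above one where `Dia` and `Bif`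
are minimal. Both are then constant, and any finite set of witnesses is a fragment. For statement 2,
the interval below finitely many witnesses is finite, and it becomes a fragment once suitable
immediate successors are added. For statement 3, the infinite binary tree satisfies the formula,
whereas a maximal world has no separated futures. -/

namespace BL

/-! ### Simple paths in a finite multigraph -/

section SimplePaths

variable {V : Type*} {E : Type} (src tgt : E → V)

/-- The list of edges `l` is a path from the vertex `x`. -/
def IsEdgePath : V → List E → Prop
  | _, [] => True
  | x, e :: l => src e = x ∧ IsEdgePath (tgt e) l

/-- The last vertex of a path that starts at `x`. -/
def pathEnd : V → List E → V
  | x, [] => x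
  | _, e :: l => pathEnd (tgt e) l

theorem pathEnd_append (x : V) (l m : List E) :
    pathEnd tgt x (l ++ m) = pathEnd tgt (pathEnd tgt x l) m := by
  induction l generalizing x with
  | nil => rfl
  | cons e l ih => exact ih (tgt e)

theorem isEdgePath_append (x : V) (l m : List E) :
    IsEdgePath src tgt x (l ++ m) ↔
      IsEdgePath src tgt x l ∧ IsEdgePath src tgt (pathEnd tgt x l) m := by
  induction l generalizing x with
  | nil => simp [IsEdgePath, pathEnd]
  | cons e l ih => simp [IsEdgePath, pathEnd, ih, and_assoc]

theorem exists_prefix_pathEnd_eq (x y : V) (l : List E) (hy : y ∈ x :: l.map tgt) :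
    ∃ m, m <+: l ∧ pathEnd tgt x m = y := by
  induction l generalizing x with
  | nil => exact ⟨[], List.prefix_refl _, by simpa [pathEnd, eq_comm] using hy⟩
  | cons e l ih =>
    rw [List.map_cons, List.mem_cons] at hy
    rcases hy with rfl | hy
    · exact ⟨[], List.nil_prefix, rfl⟩
    · obtain ⟨m, hm, h⟩ := ih (tgt e) hy
      exact ⟨e :: m, (List.prefix_cons_inj e).2 hm, h⟩

/-- Paths from `x` that visit no vertex twice. -/
def SimplePath (x : V) : Type :=
  {l : List E // IsEdgePath src tgt x l ∧ (x :: l.map tgt).Nodup}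

variable {src tgt} {x : V}

instance : PartialOrder (SimplePath src tgt x) where
  le p q := p.1 <+: q.1
  le_refl p := List.prefix_refl p.1
  le_trans _ _ _ h₁ h₂ := List.IsPrefix.trans h₁ h₂
  le_antisymm _ _ h₁ h₂ := Subtype.ext (h₁.eq_of_length (le_antisymm h₁.length_le h₂.length_le))

namespace SimplePath

theorem finite [Finite E] : Finite (SimplePath src tgt x) := by
  have := Fintype.ofFinite E
  have h : {l : List E | l.length ≤ Fintype.card E}.Finite := List.finite_length_le E _
  refine Set.Finite.to_subtype
    (s := {l | IsEdgePath src tgt x l ∧ (x :: l.map tgt).Nodup}) (h.subset ?_)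
  rintro l ⟨-, hl⟩
  -- Distinct targets force distinct edges, so a simple path is no longer than the number of edges.
  exact ((List.nodup_cons.1 hl).2.of_map tgt).length_le_card

variable (src tgt x) in
/-- The path without edges. -/
def nil : SimplePath src tgt x := ⟨[], trivial, by simp⟩

theorem isTree : IsTree (SimplePath src tgt x) where
  rooted := ⟨nil src tgt x, fun w => List.nil_prefix (l := w.1)⟩
  persistent a b _ h haa' :=
    ⟨fun h' => h.1 (le_trans haa' h'), fun h' =>
      (List.prefix_or_prefix_of_prefix (l₁ := a.1) (l₂ := b.1) haa' h').elim h.1 h.2⟩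

/-- The last vertex of a simple path. -/
def last (p : SimplePath src tgt x) : V := pathEnd tgt x p.1

/-- The vertices visited by a simple path. -/
def vertices (p : SimplePath src tgt x) : List V := x :: p.1.map tgt

/-- A prefix of a simple path is a simple path. -/
def take (p : SimplePath src tgt x) (m : List E) (h : m <+: p.1) : SimplePath src tgt x :=
  ⟨m, by
    obtain ⟨k, hk⟩ := h
    have hp := p.2
    rw [← hk, isEdgePath_append, List.map_append, ← List.cons_append] at hp
    exact ⟨hp.1.1, hp.2.of_append_left⟩⟩

theorem exists_le_last_eq (p : SimplePath src tgt x) {y : V} (hy : y ∈ p.vertices) :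
    ∃ q ≤ p, q.last = y := by
  obtain ⟨m, hm, h⟩ := exists_prefix_pathEnd_eq tgt x y p.1 hy
  exact ⟨p.take m hm, hm, h⟩

/-- The extension of a simple path by an edge to a new vertex. -/
def snoc (p : SimplePath src tgt x) (e : E) (h : src e = p.last) (h' : tgt e ∉ p.vertices) :
    SimplePath src tgt x :=
  ⟨p.1 ++ [e], by
    refine ⟨(isEdgePath_append ..).2 ⟨p.2.1, h, trivial⟩, ?_⟩
    rw [List.map_append, ← List.cons_append]
    exact List.Nodup.append p.2.2 (by simp) (by simpa [vertices] using h')⟩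

theorem covBy_of_val_eq {p q : SimplePath src tgt x} {e : E} (h : q.1 = p.1 ++ [e]) : p ⋖ q := by
  have hlen : q.1.length = p.1.length + 1 := by simp [h]
  have hle : p ≤ q := ⟨[e], h.symm⟩
  refine ⟨lt_of_le_of_ne hle fun hpq => by simp [hpq] at hlen, fun r hpr hrq => ?_⟩
  have h₁ : p.1.length < r.1.length := by
    refine lt_of_le_of_ne hpr.le.length_le fun hl => hpr.ne ?_
    exact Subtype.ext (hpr.le.eq_of_length hl)
  have h₂ : r.1.length < q.1.length := by
    refine lt_of_le_of_ne hrq.le.length_le fun hl => hrq.ne ?_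
    exact Subtype.ext (hrq.le.eq_of_length hl)
  omega

theorem exists_val_eq_of_covBy {p q : SimplePath src tgt x} (h : p ⋖ q) :
    ∃ e, q.1 = p.1 ++ [e] := by
  obtain ⟨k, hk⟩ := h.le
  cases k with
  | nil => exact absurd (Subtype.ext (by simpa using hk)) h.ne
  | cons e k =>
    refine ⟨e, ?_⟩
    let r : SimplePath src tgt x := q.take (p.1 ++ [e]) ⟨k, by simpa using hk⟩
    have hr : p ⋖ r := covBy_of_val_eq rfl
    have hrq : r ≤ q := ⟨k, by simpa [r, take] using hk⟩
    rcases hrq.lt_or_eq with hlt | heq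
    · exact absurd hlt (h.2 hr.lt)
    · exact heq ▸ rfl

end SimplePath

open SimplePath in
/-- Every finite pointed multigraph is covered by a finite tree with backlinks: the tree of simple
paths, in which an edge to a vertex already visited becomes a backlink. -/
theorem exists_backlinkModel_cover {Atom : Type v} [Finite E] (src tgt : E → V) (x : V)
    (val : V → Set Atom) :
    ∃ (N : BacklinkModel.{v} Atom) (f : N.Node → V) (g : N.Edge → E),
      f N.root = x ∧ (∀ n, N.val n = val (f n)) ∧
      (∀ e, src (g e) = f e.src) ∧ (∀ e, tgt (g e) = f e.tgt) ∧
      (∀ e e', e.src = e'.src → g e = g e' → e = e') ∧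
      (∀ n e, src e = f n → ∃ e', e'.src = n ∧ g e' = e) := by
  choose back back_le back_last using
    fun p : SimplePath src tgt x => fun y (hy : y ∈ p.vertices) => p.exists_le_last_eq hy
  let N : BacklinkModel.{v} Atom :=
    { Node := SimplePath src tgt x
      order := inferInstance
      finiteNode := SimplePath.finite
      isTree := SimplePath.isTree
      -- A backlink is an edge whose target was already visited; it returns to a prefix of the path
      -- that ends at that target.
      Link := {q : SimplePath src tgt x × E // src q.2 = q.1.last ∧ tgt q.2 ∈ q.1.vertices}
      finiteLink := by
        have : Finite (SimplePath src tgt x) := SimplePath.finite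
        infer_instance
      linkSrc := fun l => l.1.1
      linkTgt := fun l => back l.1.1 _ l.2.2
      backward := fun l => back_le _ _ _
      val := fun p => val p.last }
  have hcov : ∀ p q : N.Node, p ⋖ q → ∃ e, q.1 = p.1 ++ [e] :=
    fun p q h => exists_val_eq_of_covBy h
  choose ext hext using hcov
  let g : N.Edge → E := fun e => match e with
    | .tree a b h => ext a b h
    | .link l => l.1.2
  have htree : ∀ (a b : N.Node) (h : a ⋖ b),
      src (ext a b h) = SimplePath.last a ∧ tgt (ext a b h) = SimplePath.last b ∧
        tgt (ext a b h) ∉ SimplePath.vertices a := by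
    intro a b h
    have hb := b.2
    rw [hext a b h, isEdgePath_append, List.map_append, ← List.cons_append] at hb
    refine ⟨hb.1.2.1, ?_, ?_⟩
    · change _ = pathEnd tgt x b.1
      rw [hext a b h, pathEnd_append]
      rfl
    · exact fun hmem => (List.disjoint_of_nodup_append hb.2) hmem (by simp)
  refine ⟨N, SimplePath.last, g, ?_, fun _ => rfl, ?_, ?_, ?_, ?_⟩
  · have h : N.root = SimplePath.nil src tgt x :=
      le_antisymm (N.root_le _) (show _ <+: _ from List.nil_prefix)
    rw [h]
    rfl
  · rintro (⟨a, b, h⟩ | l)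
    · exact (htree a b h).1
    · exact l.2.1
  · rintro (⟨a, b, h⟩ | l)
    · exact (htree a b h).2.1
    · exact (back_last _ _ _).symm
  -- A tree edge leads to an unvisited vertex and a backlink to a visited one, so the mixed cases
  -- are impossible.
  · rintro (⟨a, b, h⟩ | l) (⟨a', b', h'⟩ | l') hs hg
    · obtain rfl : a = a' := hs
      obtain rfl : b = b' := Subtype.ext <| by
        rw [hext a b h, hext a b' h', show ext a b h = ext a b' h' from hg]
      rfl
    · obtain rfl : a = l'.1.1 := hs
      exact absurd l'.2.2 ((show ext _ b h = l'.1.2 from hg) ▸ (htree _ b h).2.2)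
    · obtain rfl : l.1.1 = a' := hs
      exact absurd l.2.2 ((show l.1.2 = ext _ b' h' from hg) ▸ (htree _ b' h').2.2)
    · exact congrArg _ (Subtype.ext (Prod.ext hs hg))
  · intro n e he
    by_cases hmem : tgt e ∈ SimplePath.vertices n
    · exact ⟨.link ⟨(n, e), he, hmem⟩, rfl, rfl⟩
    · let q : N.Node := SimplePath.snoc n e he hmem
      have hq : n ⋖ q := covBy_of_val_eq (show q.1 = n.1 ++ [e] from rfl)
      refine ⟨.tree n q hq, rfl, ?_⟩
      have := hext n q hq
      exact (List.singleton_injective (List.append_cancel_left this)).symm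

end SimplePaths

/-! ### Discretization of trees -/

section Discretization

variable {W : Type u} [PartialOrder W] {I : Type*}

theorem Separated.symm {a b : W} (h : Separated a b) : Separated b a := ⟨h.2, h.1⟩

theorem IsTree.separated_of_le (hW : IsTree W) {a b a' b' : W} (h : Separated a b)
    (ha : a ≤ a') (hb : b ≤ b') : Separated a' b' :=
  (hW.persistent _ _ _ (hW.persistent _ _ _ h ha).symm hb).symm

theorem IsTree.le_or_le (hW : IsTree W) {a b c : W} (ha : a ≤ c) (hb : b ≤ c) : a ≤ b ∨ b ≤ a := by
  by_contra! h
  exact (hW.persistent a b c ⟨h.1, h.2⟩ ha).2 hb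

variable (L : I → W → Prop)

/-- The property `i` holds somewhere above `x`. -/
def Dia (x : W) (i : I) : Prop := ∃ y, x ≤ y ∧ L i y

/-- The properties `i` and `j` hold at separated points above `x`. -/
def Bif (x : W) (i j : I) : Prop := ∃ y z, Bifurcates x y z ∧ L i y ∧ L j z

/-- The properties of `x` and of the pairs of points above it. -/
def signature (x : W) : (I → Prop) × (I → Prop) × (I → I → Prop) :=
  (fun i => L i x, Dia L x, Bif L x)

variable {L}

theorem Dia.mono {x y : W} {i : I} (h : Dia L y i) (hxy : x ≤ y) : Dia L x i := by
  obtain ⟨z, hz, hi⟩ := h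
  exact ⟨z, hxy.trans hz, hi⟩

theorem Bif.mono {x y : W} {i j : I} (h : Bif L y i j) (hxy : x ≤ y) : Bif L x i j := by
  obtain ⟨a, b, hab, hi, hj⟩ := h
  exact ⟨a, b, ⟨hxy.trans hab.1, hxy.trans hab.2.1, hab.2.2⟩, hi, hj⟩

theorem Dia.of_holds {x : W} {i : I} (h : L i x) : Dia L x i := ⟨x, le_rfl, h⟩

theorem IsTree.bif_of_bifurcates (hW : IsTree W) {x y z : W} {i j : I} (h : Bifurcates x y z)
    (hi : Dia L y i) (hj : Dia L z j) : Bif L x i j := by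
  obtain ⟨y', hy, hi⟩ := hi
  obtain ⟨z', hz, hj⟩ := hj
  exact ⟨y', z', ⟨h.1.trans hy, h.2.1.trans hz, hW.separated_of_le h.2.2 hy hz⟩, hi, hj⟩

theorem holds_iff_of_signature_eq {x y : W} (h : signature L x = signature L y) (i : I) :
    L i x ↔ L i y := iff_of_eq (congrFun (congrArg Prod.fst h) i)

theorem dia_iff_of_signature_eq {x y : W} (h : signature L x = signature L y) (i : I) :
    Dia L x i ↔ Dia L y i := iff_of_eq (congrFun (congrArg (fun s => s.2.1) h) i)

theorem bif_iff_of_signature_eq {x y : W} (h : signature L x = signature L y) (i j : I) :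
    Bif L x i j ↔ Bif L y i j :=
  iff_of_eq (congrFun (congrFun (congrArg (fun s => s.2.2) h) i) j)

variable (L)

/-- A finite multigraph whose vertices and edges carry points of `W`, with the transitions and the
bifurcations required by the points. -/
structure Realization where
  Vertex : Type u
  Edge : Type
  finiteEdge : Finite Edge
  src : Edge → Vertex
  tgt : Edge → Vertex
  point : Vertex → W
  edgePoint : Edge → W
  le_edgePoint : ∀ e, point (src e) ≤ edgePoint e
  signature_edgePoint : ∀ e, signature L (edgePoint e) = signature L (point (tgt e))
  separated : ∀ e e', src e = src e' → e ≠ e' → Separated (edgePoint e) (edgePoint e')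
  exists_vertex : ∀ x, ∃ v, signature L (point v) = signature L x
  exists_of_dia : ∀ v i, Dia L (point v) i →
    ∃ v', Relation.ReflTransGen (fun a b => ∃ e, src e = a ∧ tgt e = b) v v' ∧ L i (point v')
  exists_of_bif : ∀ v i j, Bif L (point v) i j →
    ∃ e e', e ≠ e' ∧ src e = src e' ∧
      Relation.ReflTransGen (fun a b => ∃ e, src e = a ∧ tgt e = b) v (src e) ∧
      Dia L (edgePoint e) i ∧ Dia L (edgePoint e') j

/-- A finite set of points above `w` that meets the obligations of `w` and in which the obligations
of a point are met or passed on to larger points. -/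
structure IsFragment (w : W) (T : Set W) : Prop where
  finite : T.Finite
  mem : w ∈ T
  le : ∀ x ∈ T, w ≤ x
  root_dia : ∀ i, Dia L w i → ∃ y ∈ T, L i y
  root_star : ∀ i j, Bif L w i j → ∃ y ∈ T, ∃ z ∈ T, Separated y z ∧ Dia L y i ∧ Dia L z j
  dia : ∀ x ∈ T, (∃ z ∈ T, x < z) → ∀ i, Dia L x i → L i x ∨ ∃ y ∈ T, x < y ∧ Dia L y i
  star : ∀ x ∈ T, (∃ z ∈ T, x < z) → ∀ i j, Bif L x i j →
    (∃ y ∈ T, x < y ∧ Bif L y i j) ∨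
      ∃ y ∈ T, ∃ z ∈ T, Bifurcates x y z ∧ Dia L y i ∧ Dia L z j

variable {L}

/-- Signatures take values in a finite type, so one chosen world for each value that occurs
suffices. -/
theorem exists_representatives [Finite I] (L : I → W → Prop) :
    ∃ rep : W → W, (Set.range rep).Finite ∧ (∀ x, signature L (rep x) = signature L x) ∧
      (∀ x y, signature L x = signature L y → rep x = rep y) := by
  let F : W → Set.range (signature L) := fun x => ⟨signature L x, x, rfl⟩
  refine ⟨fun x => Set.rangeSplitting (signature L) (F x), ?_, fun x => ?_, fun x y h => ?_⟩
  · refine (Set.finite_range (Set.rangeSplitting (signature L))).subset ?_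
    rintro _ ⟨x, rfl⟩
    exact ⟨F x, rfl⟩
  · exact Set.apply_rangeSplitting (signature L) (F x)
  · exact congrArg (Set.rangeSplitting (signature L)) (Subtype.ext h)

variable (L) in
/-- Finitely many representatives of the signatures, with a fragment above each of them. -/
structure FragmentSystem where
  rep : W → W
  fragment : W → Set W
  finite_range : (Set.range rep).Finite
  signature_rep : ∀ x, signature L (rep x) = signature L x
  rep_eq : ∀ x y, signature L x = signature L y → rep x = rep y
  isFragment : ∀ x, IsFragment L x (fragment x)

/-! ### Gluing fragments into a finite multigraph -/

namespace FragmentSystem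

variable (S : FragmentSystem L)

instance : Finite (Set.range S.rep) := S.finite_range

instance (r : W) : Finite (S.fragment r) := (S.isFragment r).finite

theorem rep_range (r : Set.range S.rep) : S.rep r = r := by
  obtain ⟨_, x, rfl⟩ := r
  exact S.rep_eq _ _ (S.signature_rep x)

/-- The root of the fragment above a representative. -/
def root (r : Set.range S.rep) : S.fragment r := ⟨r, (S.isFragment r).mem⟩

open Classical in
/-- The pair that stands for a point of a fragment: a maximal point is replaced by the root of the
fragment above its representative. -/
noncomputable def pair (r : Set.range S.rep) (x : S.fragment r) : W × W :=
  if IsMax x then (S.rep x, S.rep x) else (r, x)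

/-- The vertices of the multigraph assembled from the fragments. -/
def Vertex : Type u := {v : W × W // ∃ r x, v = S.pair r x}

/-- The vertex that stands for a point of a fragment. -/
noncomputable def node (r : Set.range S.rep) (x : S.fragment r) : S.Vertex := ⟨S.pair r x, r, x, rfl⟩

/-- The edges lead from a point of a fragment to its immediate successors in the fragment. -/
def Arrow : Type u :=
  Σ r : Set.range S.rep, Σ x : S.fragment r, {y : S.fragment r // Minimal (fun z => x < z) y}

instance : Finite S.Arrow := by unfold Arrow; infer_instance

/-- The start of an edge. -/
noncomputable def src (e : S.Arrow) : S.Vertex := S.node e.1 e.2.1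

/-- The end of an edge. -/
noncomputable def tgt (e : S.Arrow) : S.Vertex := S.node e.1 e.2.2.1

/-- Reachability along the edges. -/
def Reach : S.Vertex → S.Vertex → Prop :=
  Relation.ReflTransGen fun a b => ∃ e, S.src e = a ∧ S.tgt e = b

theorem signature_node (r : Set.range S.rep) (x : S.fragment r) :
    signature L (S.node r x).1.2 = signature L x := by
  unfold node pair
  split_ifs
  · exact S.signature_rep x
  · rfl

theorem node_of_isMax {r : Set.range S.rep} {x : S.fragment r} (h : IsMax x) :
    S.node r x = S.node ⟨S.rep x, x, rfl⟩ (S.root _) := by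
  have hr := S.rep_range ⟨S.rep x, x, rfl⟩
  refine Subtype.ext ?_
  simp only [node, pair, if_pos h]
  -- The root may itself be maximal, when its fragment is a singleton; it is then its own
  -- representative, so both forms of `pair` agree.
  split_ifs
  · exact congrArg (fun w => (w, w)) hr.symm
  · rfl

theorem val_node_of_not_isMax {r : Set.range S.rep} {x : S.fragment r} (h : ¬ IsMax x) :
    (S.node r x).1 = (r.1, x.1) := if_neg h

theorem exists_arrow {r : Set.range S.rep} {x y : S.fragment r} (h : x < y) :
    ∃ z, z ≤ y ∧ Minimal (fun z => x < z) z := Finite.exists_le_minimal h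

theorem reach_of_le (r : Set.range S.rep) {x y : S.fragment r} (h : x ≤ y) :
    S.Reach (S.node r x) (S.node r y) := by
  induction x using WellFoundedGT.induction with
  | ind x ih =>
    rcases h.eq_or_lt with rfl | hlt
    · exact .refl
    · obtain ⟨z, hzy, hz⟩ := S.exists_arrow hlt
      exact .head ⟨⟨r, x, z, hz⟩, rfl, rfl⟩ (ih z hz.prop hzy)

/-- An obligation moves up the fragment until it is met or reaches a maximal point. There the walk
continues at the root of another fragment, which contains a witness. -/
theorem exists_reach_of_dia (r : Set.range S.rep) (x : S.fragment r) {i : I} (h : Dia L x.1 i) :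
    ∃ v, S.Reach (S.node r x) v ∧ L i v.1.2 := by
  have hroot : ∀ r : Set.range S.rep, Dia L r.1 i →
      ∃ v, S.Reach (S.node r (S.root r)) v ∧ L i v.1.2 := by
    intro r hr
    obtain ⟨y, hy, hi⟩ := (S.isFragment r).root_dia i hr
    refine ⟨S.node r ⟨y, hy⟩, S.reach_of_le r ((S.isFragment r).le y hy), ?_⟩
    exact (holds_iff_of_signature_eq (S.signature_node r ⟨y, hy⟩) i).2 hi
  induction x using WellFoundedGT.induction with
  | ind x ih =>
    by_cases hx : IsMax x
    · rw [S.node_of_isMax hx]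
      exact hroot _ ((dia_iff_of_signature_eq (S.signature_rep x) i).2 h)
    · obtain ⟨z, hz⟩ := not_isMax_iff.1 hx
      rcases (S.isFragment r).dia x x.2 ⟨z, z.2, hz⟩ i h with hi | ⟨y, hy, hxy, hi⟩
      · exact ⟨_, .refl, (holds_iff_of_signature_eq (S.signature_node r x) i).2 hi⟩
      · obtain ⟨v, hv, hvi⟩ := ih ⟨y, hy⟩ hxy hi
        exact ⟨v, (S.reach_of_le r (show x ≤ ⟨y, hy⟩ from hxy.le)).trans hv, hvi⟩

variable (L) in
/-- Some edges `e` and `e'` bifurcate at a vertex reachable from `v`, towards `i` and `j`. -/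
def Forks (S : FragmentSystem L) (v : S.Vertex) (i j : I) : Prop :=
  ∃ e e', e ≠ e' ∧ S.src e = S.src e' ∧ S.Reach v (S.src e) ∧
    Dia L e.2.2.1.1 i ∧ Dia L e'.2.2.1.1 j

theorem forks_of_bifurcates (r : Set.range S.rep) {x y z : S.fragment r} {i j : I}
    (h : Bifurcates x y z) (hi : Dia L y.1 i) (hj : Dia L z.1 j) :
    S.Forks L (S.node r x) i j := by
  -- The fork is at a maximal common lower bound `m` of `y` and `z`: if the steps from `m` towards
  -- them coincided, their target would be a larger one.
  obtain ⟨m, hxm, hm⟩ := Finite.exists_le_maximal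
    (p := fun m : S.fragment r => m ≤ y ∧ m ≤ z) ⟨h.1, h.2.1⟩
  have hmy : m < y := lt_of_le_of_ne hm.prop.1 fun heq => h.2.2.1 (heq ▸ hm.prop.2)
  have hmz : m < z := lt_of_le_of_ne hm.prop.2 fun heq => h.2.2.2 (heq ▸ hm.prop.1)
  obtain ⟨y', hy', hmy'⟩ := S.exists_arrow hmy
  obtain ⟨z', hz', hmz'⟩ := S.exists_arrow hmz
  refine ⟨⟨r, m, y', hmy'⟩, ⟨r, m, z', hmz'⟩, fun heq => ?_, rfl, S.reach_of_le r hxm,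
    hi.mono hy', hj.mono hz'⟩
  cases heq
  exact hmy'.prop.not_ge (hm.le_of_ge ⟨hy', hz'⟩ hmy'.prop.le)

theorem Forks.of_reach {S : FragmentSystem L} {v v' : S.Vertex} {i j : I} (h : S.Forks L v' i j)
    (hv : S.Reach v v') : S.Forks L v i j := by
  obtain ⟨e, e', hne, hs, hr, hi, hj⟩ := h
  exact ⟨e, e', hne, hs, hv.trans hr, hi, hj⟩

theorem forks_of_bif (r : Set.range S.rep) (x : S.fragment r) {i j : I} (h : Bif L x.1 i j) :
    S.Forks L (S.node r x) i j := by
  have hroot : ∀ r : Set.range S.rep, Bif L r.1 i j → S.Forks L (S.node r (S.root r)) i j := by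
    intro r hr
    obtain ⟨y, hy, z, hz, hyz, hi, hj⟩ := (S.isFragment r).root_star i j hr
    exact S.forks_of_bifurcates r (x := S.root r) (y := ⟨y, hy⟩) (z := ⟨z, hz⟩)
      ⟨(S.isFragment r).le y hy, (S.isFragment r).le z hz, hyz⟩ hi hj
  induction x using WellFoundedGT.induction with
  | ind x ih =>
    by_cases hx : IsMax x
    · rw [S.node_of_isMax hx]
      exact hroot _ ((bif_iff_of_signature_eq (S.signature_rep x) i j).2 h)
    · obtain ⟨z, hz⟩ := not_isMax_iff.1 hx
      rcases (S.isFragment r).star x x.2 ⟨z, z.2, hz⟩ i j h with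
        ⟨y, hy, hxy, hi⟩ | ⟨y, hy, z, hz, hyz, hi, hj⟩
      · exact (ih ⟨y, hy⟩ hxy hi).of_reach (S.reach_of_le r (show x ≤ ⟨y, hy⟩ from hxy.le))
      · exact S.forks_of_bifurcates r (y := ⟨y, hy⟩) (z := ⟨z, hz⟩) hyz hi hj

theorem src_eq {r : Set.range S.rep} {x y : S.fragment r} (h : x < y) :
    (S.node r x).1 = (r.1, x.1) := S.val_node_of_not_isMax fun hx => hx.not_lt h

/-- The source of an edge is not maximal, so its vertex determines the fragment and the point. Two
distinct minimal points above that point are incomparable. -/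
theorem separated_of_src_eq {e e' : S.Arrow} (h : S.src e = S.src e') (hne : e ≠ e') :
    Separated e.2.2.1.1 e'.2.2.1.1 := by
  obtain ⟨r, x, y, hy⟩ := e
  obtain ⟨r', x', y', hy'⟩ := e'
  have h' : (r.1, x.1) = (r'.1, x'.1) := by
    rw [← S.src_eq hy.prop, ← S.src_eq hy'.prop]
    exact congrArg Subtype.val h
  obtain rfl : r = r' := Subtype.ext (congrArg Prod.fst h')
  obtain rfl : x = x' := Subtype.ext (congrArg Prod.snd h')
  have hyy : y ≠ y' := by
    rintro rfl
    exact hne rfl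
  exact ⟨fun hle => hyy (hy'.eq_of_le hy.prop hle), fun hle => hyy (hy.eq_of_le hy'.prop hle).symm⟩

theorem nonempty_realization (S : FragmentSystem L) : Nonempty (Realization L) := by
  -- Arrows live in the universe of `W`; numbering them moves the edges to `Type`, where backlink
  -- models live.
  obtain ⟨n, ⟨f⟩⟩ := Finite.exists_equiv_fin S.Arrow
  have hreach : ∀ {v v'}, S.Reach v v' → Relation.ReflTransGen
      (fun a b => ∃ k, S.src (f.symm k) = a ∧ S.tgt (f.symm k) = b) v v' :=
    Relation.ReflTransGen.mono
      (fun a b ⟨e, ha, hb⟩ => ⟨f e, by simpa using ha, by simpa using hb⟩ :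
        (fun a b => ∃ e, S.src e = a ∧ S.tgt e = b) ≤ _) _ _
  exact ⟨{
    Vertex := S.Vertex
    Edge := Fin n
    finiteEdge := inferInstance
    src := fun k => S.src (f.symm k)
    tgt := fun k => S.tgt (f.symm k)
    point := fun v => v.1.2
    edgePoint := fun k => (f.symm k).2.2.1
    le_edgePoint := fun k => by
      have hlt := (f.symm k).2.2.2.prop
      rw [src, S.src_eq hlt]
      exact hlt.le
    signature_edgePoint := fun k => (S.signature_node _ _).symm
    separated := fun k k' h hne => S.separated_of_src_eq h (f.symm.injective.ne hne)
    exists_vertex := fun x => by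
      let r : Set.range S.rep := ⟨S.rep x, x, rfl⟩
      exact ⟨S.node r (S.root r), (S.signature_node r (S.root r)).trans (S.signature_rep x)⟩
    exists_of_dia := by
      rintro ⟨_, r, x, rfl⟩ i h
      obtain ⟨v, hv, hi⟩ := S.exists_reach_of_dia r x
        ((dia_iff_of_signature_eq (S.signature_node r x) i).1 h)
      exact ⟨v, hreach hv, hi⟩
    exists_of_bif := by
      rintro ⟨_, r, x, rfl⟩ i j h
      obtain ⟨e, e', hne, hs, hr, hi, hj⟩ := S.forks_of_bif r x
        ((bif_iff_of_signature_eq (S.signature_node r x) i j).1 h)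
      refine ⟨f e, f e', f.injective.ne hne, ?_, ?_, ?_, ?_⟩
      · simpa using hs
      · rw [f.symm_apply_apply]
        exact hreach hr
      · rw [f.symm_apply_apply]
        exact hi
      · rw [f.symm_apply_apply]
        exact hj }⟩

end FragmentSystem

end Discretization

theorem exists_fork_of_not_prefix {α : Type*} {l m : List α} (h : ¬ l <+: m) (h' : ¬ m <+: l) :
    ∃ c a b l' m', a ≠ b ∧ l = c ++ a :: l' ∧ m = c ++ b :: m' := by
  induction l generalizing m with
  | nil => exact absurd List.nil_prefix h
  | cons a l ih =>
    cases m with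
    | nil => exact absurd List.nil_prefix h'
    | cons b m =>
      by_cases hab : a = b
      · subst hab
        rw [List.prefix_cons_inj] at h h'
        obtain ⟨c, a', b', l', m', hne, rfl, rfl⟩ := ih h h'
        exact ⟨a :: c, a', b', l', m', hne, rfl, rfl⟩
      · exact ⟨[], a, b, l, m, hab, rfl, rfl⟩

/-! ### Truth in the unfolding of a realization -/

section Truth

variable {Atom : Type v} {W : Type u} [PartialOrder W] {I : Type*} {L : I → W → Prop}

namespace BacklinkModel

theorem walkEnd_append (N : BacklinkModel.{v} Atom) (n : N.Node) (l m : List N.Edge) :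
    N.walkEnd n (l ++ m) = N.walkEnd (N.walkEnd n l) m := by
  induction l generalizing n with
  | nil => rfl
  | cons e l ih => exact ih e.tgt

theorem isWalk_append (N : BacklinkModel.{v} Atom) (n : N.Node) (l m : List N.Edge) :
    N.IsWalk n (l ++ m) ↔ N.IsWalk n l ∧ N.IsWalk (N.walkEnd n l) m := by
  induction l generalizing n with
  | nil => simp [IsWalk, walkEnd]
  | cons e l ih => simp [IsWalk, walkEnd, ih, and_assoc]

/-- The nodes and edges of the model with backlinks carry points of `W`, with the transitions and
the bifurcations required by the points. -/
structure Realizes (N : BacklinkModel.{v} Atom) (L : I → W → Prop) (point : N.Node → W)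
    (edgePoint : N.Edge → W) : Prop where
  le_edgePoint : ∀ e : N.Edge, point e.src ≤ edgePoint e
  signature_edgePoint : ∀ e : N.Edge, signature L (edgePoint e) = signature L (point e.tgt)
  separated : ∀ e e' : N.Edge, e.src = e'.src → e ≠ e' → Separated (edgePoint e) (edgePoint e')
  exists_of_dia : ∀ n i, Dia L (point n) i → ∃ l, N.IsWalk n l ∧ L i (point (N.walkEnd n l))
  exists_of_bif : ∀ n i j, Bif L (point n) i j →
    ∃ (e e' : N.Edge) (l : List N.Edge), e ≠ e' ∧ e.src = e'.src ∧ N.IsWalk n l ∧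
      N.walkEnd n l = e.src ∧ Dia L (edgePoint e) i ∧ Dia L (edgePoint e') j

theorem exists_realizes (R : Realization L) (val : W → Set Atom) (v : R.Vertex) :
    ∃ (N : BacklinkModel.{v} Atom) (point : N.Node → W) (edgePoint : N.Edge → W),
      N.Realizes L point edgePoint ∧ point N.root = R.point v ∧ ∀ n, N.val n = val (point n) := by
  have := R.finiteEdge
  obtain ⟨N, f, g, hroot, hval, hsrc, htgt, hinj, hsurj⟩ :=
    exists_backlinkModel_cover R.src R.tgt v (fun v => val (R.point v))
  have hwalk : ∀ {a b : R.Vertex},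
      Relation.ReflTransGen (fun a b => ∃ e, R.src e = a ∧ R.tgt e = b) a b →
      ∀ n, f n = a → ∃ l, N.IsWalk n l ∧ f (N.walkEnd n l) = b := by
    intro a b h
    induction h using Relation.ReflTransGen.head_induction_on with
    | refl => exact fun n hn => ⟨[], trivial, hn⟩
    | head hstep _ ih =>
      obtain ⟨e, rfl, rfl⟩ := hstep
      intro n hn
      obtain ⟨e', rfl, rfl⟩ := hsurj n e hn.symm
      obtain ⟨l, hl, hl'⟩ := ih e'.tgt (htgt e').symm
      exact ⟨e' :: l, ⟨rfl, hl⟩, hl'⟩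
  refine ⟨N, fun n => R.point (f n), fun e => R.edgePoint (g e), ⟨?_, ?_, ?_, ?_, ?_⟩,
    congrArg _ hroot, hval⟩
  · intro e
    simpa [hsrc] using R.le_edgePoint (g e)
  · intro e
    simpa [htgt] using R.signature_edgePoint (g e)
  · intro e e' h hne
    exact R.separated _ _ (by rw [hsrc, hsrc, h]) fun hg => hne (hinj e e' h hg)
  · intro n i h
    obtain ⟨v', hv', hi⟩ := R.exists_of_dia _ i h
    obtain ⟨l, hl, rfl⟩ := hwalk hv' n rfl
    exact ⟨l, hl, hi⟩
  · intro n i j h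
    obtain ⟨e, e', hne, hs, hr, hi, hj⟩ := R.exists_of_bif _ i j h
    obtain ⟨l, hl, hl'⟩ := hwalk hr n rfl
    obtain ⟨d, hd, rfl⟩ := hsurj (N.walkEnd n l) e hl'.symm
    obtain ⟨d', hd', rfl⟩ := hsurj (N.walkEnd n l) e' (hs ▸ hl'.symm)
    exact ⟨d, d', l, fun h => hne (congrArg g h), hd.trans hd'.symm, hl, hd.symm, hi, hj⟩

/-! ### Obligations along walks of the unfolding -/

namespace Realizes

variable {N : BacklinkModel.{v} Atom} {point : N.Node → W} {edgePoint : N.Edge → W}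

/-- Walks need not climb in `W`. Each edge goes up to its edge point and then jumps to a world of
the same signature, and `Dia` can be pulled back through both moves. -/
theorem dia_of_walk (h : N.Realizes L point edgePoint) {n : N.Node} {l : List N.Edge} {i : I}
    (hl : N.IsWalk n l) (hi : Dia L (point (N.walkEnd n l)) i) : Dia L (point n) i := by
  induction l generalizing n with
  | nil => exact hi
  | cons e l ih =>
    obtain ⟨rfl, hl⟩ := hl
    exact ((dia_iff_of_signature_eq (h.signature_edgePoint e) i).2 (ih hl hi)).mono
      (h.le_edgePoint e)

theorem bif_of_walk (h : N.Realizes L point edgePoint) {n : N.Node} {l : List N.Edge} {i j : I}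
    (hl : N.IsWalk n l) (hi : Bif L (point (N.walkEnd n l)) i j) : Bif L (point n) i j := by
  induction l generalizing n with
  | nil => exact hi
  | cons e l ih =>
    obtain ⟨rfl, hl⟩ := hl
    exact ((bif_iff_of_signature_eq (h.signature_edgePoint e) i j).2 (ih hl hi)).mono
      (h.le_edgePoint e)

/-- The point carried by a world of the unfolding. -/
noncomputable def worldPoint {W : Type*} (point : N.Node → W) (x : N.UnfoldedWorld) : W := point (N.walkEnd N.root x.1)

/-- The continuation of a walk from the root by another walk. -/
def extend (x : N.UnfoldedWorld) (l : List N.Edge) (hl : N.IsWalk (N.walkEnd N.root x.1) l) :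
    N.UnfoldedWorld := ⟨x.1 ++ l, (N.isWalk_append _ _ _).2 ⟨x.2, hl⟩⟩

theorem worldPoint_extend {W : Type*} (point : N.Node → W) (x : N.UnfoldedWorld) (l : List N.Edge)
    (hl : N.IsWalk (N.walkEnd N.root x.1) l) :
    worldPoint point (extend x l hl) = point (N.walkEnd (N.walkEnd N.root x.1) l) :=
  congrArg point (N.walkEnd_append _ _ _)

theorem le_extend (x : N.UnfoldedWorld) (l : List N.Edge)
    (hl : N.IsWalk (N.walkEnd N.root x.1) l) : x ≤ extend x l hl := List.prefix_append _ _

theorem exists_eq_extend {x y : N.UnfoldedWorld} (h : x ≤ y) : ∃ l hl, y = extend x l hl := by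
  obtain ⟨l, hl⟩ := h
  have hy := y.2
  rw [← hl] at hy
  exact ⟨l, ((N.isWalk_append _ _ _).1 hy).2, Subtype.ext hl.symm⟩

theorem dia_worldPoint_iff (h : N.Realizes L point edgePoint) (x : N.UnfoldedWorld) (i : I) :
    Dia L (worldPoint point x) i ↔ ∃ y, x ≤ y ∧ L i (worldPoint point y) := by
  constructor
  · intro hi
    obtain ⟨l, hl, hi⟩ := h.exists_of_dia _ i hi
    exact ⟨extend x l hl, le_extend x l hl, by rwa [worldPoint_extend]⟩
  · rintro ⟨y, hxy, hi⟩
    obtain ⟨l, hl, rfl⟩ := exists_eq_extend hxy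
    rw [worldPoint_extend] at hi
    exact h.dia_of_walk hl (.of_holds hi)

theorem bif_worldPoint_iff (h : N.Realizes L point edgePoint) (hW : IsTree W)
    (x : N.UnfoldedWorld) (i j : I) :
    Bif L (worldPoint point x) i j ↔
      ∃ y z, Bifurcates x y z ∧ L i (worldPoint point y) ∧ L j (worldPoint point z) := by
  constructor
  · intro hij
    obtain ⟨e, e', l, hne, hs, hl, hend, hi, hj⟩ := h.exists_of_bif _ i j hij
    -- The obligations pass from the edge points to the ends of the two edges, where walks can meet
    -- them.
    rw [dia_iff_of_signature_eq (h.signature_edgePoint _)] at hi hj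
    obtain ⟨a, ha, hi⟩ := h.exists_of_dia _ i hi
    obtain ⟨b, hb, hj⟩ := h.exists_of_dia _ j hj
    have ha' : N.IsWalk (N.walkEnd N.root x.1) (l ++ e :: a) :=
      (N.isWalk_append _ _ _).2 ⟨hl, hend.symm, ha⟩
    have hb' : N.IsWalk (N.walkEnd N.root x.1) (l ++ e' :: b) :=
      (N.isWalk_append _ _ _).2 ⟨hl, hs ▸ hend.symm, hb⟩
    have key : ∀ {d d' : N.Edge} {s t : List N.Edge}, d ≠ d' →
        ¬ x.1 ++ (l ++ d :: s) <+: x.1 ++ (l ++ d' :: t) := by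
      intro d d' s t hd hp
      rw [List.prefix_append_right_inj, List.prefix_append_right_inj, List.cons_prefix_cons] at hp
      exact hd hp.1
    refine ⟨extend x _ ha', extend x _ hb', ⟨le_extend .., le_extend .., key hne, key hne.symm⟩,
      ?_, ?_⟩
    · rw [worldPoint_extend, walkEnd_append]
      exact hi
    · rw [worldPoint_extend, walkEnd_append]
      exact hj
  · rintro ⟨y, z, ⟨hxy, hxz, hyz⟩, hi, hj⟩
    obtain ⟨l, hl, rfl⟩ := exists_eq_extend hxy
    obtain ⟨m, hm, rfl⟩ := exists_eq_extend hxz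
    -- The walks part after `c`, along distinct edges from one node. Their edge points are
    -- separated, which gives a bifurcation in `W` at that node, and it is pulled back along `c`.
    obtain ⟨c, e, e', a, b, hne, rfl, rfl⟩ := exists_fork_of_not_prefix
      (fun hp => hyz.1 ((List.prefix_append_right_inj x.1).2 hp))
      (fun hp => hyz.2 ((List.prefix_append_right_inj x.1).2 hp))
    rw [worldPoint_extend, walkEnd_append] at hi hj
    obtain ⟨hc, hs, ha⟩ := (N.isWalk_append _ _ _).1 hl
    obtain ⟨-, hs', hb⟩ := (N.isWalk_append _ _ _).1 hm
    refine h.bif_of_walk hc (hW.bif_of_bifurcates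
      ⟨hs ▸ h.le_edgePoint e, hs' ▸ h.le_edgePoint e', h.separated e e' (hs.trans hs'.symm) hne⟩
      ?_ ?_)
    · exact (dia_iff_of_signature_eq (h.signature_edgePoint e) i).2 (h.dia_of_walk ha (.of_holds hi))
    · exact (dia_iff_of_signature_eq (h.signature_edgePoint e') j).2 (h.dia_of_walk hb (.of_holds hj))

end Realizes

end BacklinkModel

/-- The set of subformulas. -/
def Formula.subformulas {Atom : Type v} : Formula Atom → Set (Formula Atom)
  | .atom p => {.atom p}
  | .neg A => insert (.neg A) A.subformulas
  | .and A B => insert (.and A B) (A.subformulas ∪ B.subformulas)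
  | .box A => insert (.box A) A.subformulas
  | .star A B => insert (.star A B) (A.subformulas ∪ B.subformulas)
  | .wand A B => insert (.wand A B) (A.subformulas ∪ B.subformulas)

theorem Formula.finite_subformulas (A : Formula Atom) : A.subformulas.Finite := by
  induction A with
  | atom p => exact Set.finite_singleton _
  | neg A ih => exact ih.insert _
  | and A B ihA ihB => exact (ihA.union ihB).insert _
  | box A ih => exact ih.insert _
  | star A B ihA ihB => exact (ihA.union ihB).insert _
  | wand A B ihA ihB => exact (ihA.union ihB).insert _

theorem Formula.mem_subformulas (A : Formula Atom) : A ∈ A.subformulas := by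
  cases A <;> simp [subformulas]

/-- Truth of the formulas in `K` and of their negations, as properties of worlds. -/
def Model.literal (M : Model.{u, v} Atom) (K : Set (Formula Atom)) (i : K × Bool) (w : M.World) :
    Prop := M.Holds w i.1 ↔ i.2 = true

open BacklinkModel.Realizes in
theorem BacklinkModel.Realizes.holds_unfolding_iff {M : Model.{u, v} Atom} {K : Set (Formula Atom)}
    {N : BacklinkModel.{v} Atom} {point : N.Node → M.World} {edgePoint : N.Edge → M.World}
    (h : N.Realizes (M.literal K) point edgePoint) (hval : ∀ n, N.val n = M.val (point n))
    (A : Formula Atom) (hA : A.WandFree) (hK : A.subformulas ⊆ K) (x : N.UnfoldedWorld) :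
    N.unfolding.Holds x A ↔ M.Holds (worldPoint point x) A := by
  induction A generalizing x with
  | atom p => exact iff_of_eq (congrArg (p ∈ ·) (hval _))
  | neg A ih => exact not_congr (ih hA ((Set.subset_insert _ _).trans hK) x)
  | and A B ihA ihB =>
    have hK' := (Set.subset_insert _ _).trans hK
    exact and_congr (ihA hA.1 (Set.subset_union_left.trans hK') x)
      (ihB hA.2 (Set.subset_union_right.trans hK') x)
  | box A ih =>
    have hK' := (Set.subset_insert _ _).trans hK
    -- `□A` fails exactly when the property "`A` is false" holds somewhere above; this is what the
    -- negative literals are for.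
    have hdia := h.dia_worldPoint_iff x (⟨A, hK' A.mem_subformulas⟩, false)
    simp only [Dia, Model.literal, Bool.false_eq_true, iff_false] at hdia
    have hbox := not_congr hdia
    push Not at hbox
    exact (forall₂_congr fun y _ => ih hA hK' y).trans hbox.symm
  | star A B ihA ihB =>
    have hK' := (Set.subset_insert _ _).trans hK
    have hKA := Set.subset_union_left.trans hK'
    have hKB := Set.subset_union_right.trans hK'
    have hbif := h.bif_worldPoint_iff M.isTree x (⟨A, hKA A.mem_subformulas⟩, true)
      (⟨B, hKB B.mem_subformulas⟩, true)
    simp only [Bif, Model.literal, iff_true] at hbif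
    exact (exists₂_congr fun y z => and_congr_right fun _ =>
      and_congr (ihA hA.1 hKA y) (ihB hA.2 hKB z)).trans hbif.symm
  | wand A B => exact hA.elim

theorem Model.exists_backlinkModel_of_fragments (M : Model.{u, v} Atom) (φ : Formula Atom)
    (hφ : φ.WandFree)
    (hM : ∀ w, ∃ T, IsFragment (M.literal φ.subformulas) w T) (w : M.World) :
    ∃ (N : BacklinkModel.{v} Atom) (f : N.UnfoldedWorld → M.World),
      (∀ x, N.unfolding.Holds x φ ↔ M.Holds (f x) φ) ∧
      (M.Holds (f N.unfoldedRoot) φ ↔ M.Holds w φ) := by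
  have := φ.finite_subformulas.to_subtype
  choose T hT using hM
  obtain ⟨rep, hfin, hsig, heq⟩ := exists_representatives (M.literal φ.subformulas)
  obtain ⟨R⟩ := FragmentSystem.nonempty_realization
    { rep := rep, fragment := T, finite_range := hfin, signature_rep := hsig, rep_eq := heq,
      isFragment := hT }
  obtain ⟨v, hv⟩ := R.exists_vertex w
  obtain ⟨N, point, edgePoint, hN, hroot, hval⟩ := BacklinkModel.exists_realizes R M.val v
  refine ⟨N, BacklinkModel.Realizes.worldPoint point, fun x =>
    hN.holds_unfolding_iff hval φ hφ subset_rfl x, ?_⟩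
  have hv' := holds_iff_of_signature_eq hv (⟨φ, φ.mem_subformulas⟩, true)
  simp only [Model.literal, iff_true] at hv'
  rw [← hv', ← hroot]
  rfl

end Truth

/-! ### Existence of fragments -/

section FragmentExistence

variable {W : Type u} [PartialOrder W] {I : Type*} {L : I → W → Prop}

theorem exists_finite_forall_of_mono {α ι : Type*} [Finite ι] {S : Set α} {P : ι → Set α → Prop}
    (hP : ∀ k C D, C ⊆ D → P k C → P k D) (h : ∀ k, ∃ C, C.Finite ∧ C ⊆ S ∧ P k C) :
    ∃ C, C.Finite ∧ C ⊆ S ∧ ∀ k, P k C := by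
  choose C hfin hS hC using h
  exact ⟨⋃ k, C k, Set.finite_iUnion hfin, Set.iUnion_subset hS,
    fun k => hP k _ _ (Set.subset_iUnion C k) (hC k)⟩

theorem exists_finite_witnesses [Finite I] (L : I → W → Prop) (w : W) :
    ∃ F : Set W, F.Finite ∧ w ∈ F ∧ F ⊆ Set.Ici w ∧ (∀ i, Dia L w i → ∃ y ∈ F, L i y) ∧
      ∀ i j, Bif L w i j → ∃ y ∈ F, ∃ z ∈ F, Separated y z ∧ Dia L y i ∧ Dia L z j := by
  obtain ⟨F, hF, hFw, hdia⟩ := exists_finite_forall_of_mono (S := Set.Ici w)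
    (P := fun i F => Dia L w i → ∃ y ∈ F, L i y)
    (fun i C D hCD h hi => (h hi).imp fun y hy => ⟨hCD hy.1, hy.2⟩) (fun i => by
      by_cases h : Dia L w i
      · obtain ⟨y, hy, hi⟩ := h
        exact ⟨{y}, Set.finite_singleton y, by simpa using hy, fun _ => ⟨y, rfl, hi⟩⟩
      · exact ⟨∅, Set.finite_empty, Set.empty_subset _, fun hi => absurd hi h⟩)
  obtain ⟨G, hG, hGw, hbif⟩ := exists_finite_forall_of_mono (S := Set.Ici w)
    (P := fun (p : I × I) F => Bif L w p.1 p.2 →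
      ∃ y ∈ F, ∃ z ∈ F, Separated y z ∧ Dia L y p.1 ∧ Dia L z p.2)
    (fun p C D hCD h hi => by
      obtain ⟨y, hy, z, hz, h⟩ := h hi
      exact ⟨y, hCD hy, z, hCD hz, h⟩) (fun p => by
      by_cases h : Bif L w p.1 p.2
      · obtain ⟨y, z, hyz, hi, hj⟩ := h
        refine ⟨{y, z}, Set.toFinite _, ?_, fun _ =>
          ⟨y, by simp, z, by simp, hyz.2.2, .of_holds hi, .of_holds hj⟩⟩
        exact Set.insert_subset hyz.1 (Set.singleton_subset_iff.2 hyz.2.1)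
      · exact ⟨∅, Set.finite_empty, Set.empty_subset _, fun hi => absurd hi h⟩)
  refine ⟨insert w (F ∪ G), (hF.union hG).insert w, Set.mem_insert _ _,
    Set.insert_subset le_rfl (Set.union_subset hFw hGw), fun i hi => ?_, fun i j hij => ?_⟩
  · obtain ⟨y, hy, h⟩ := hdia i hi
    exact ⟨y, .inr (.inl hy), h⟩
  · obtain ⟨y, hy, z, hz, h⟩ := hbif (i, j) hij
    exact ⟨y, .inr (.inr hy), z, .inr (.inr hz), h⟩

/-- When all worlds have the same obligations, each non-maximal point passes its own to any larger
point of the set. Immediate successors are not needed, so the order may be dense. -/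
theorem exists_fragment_of_constant [Finite I] (hdia : ∀ x y i, Dia L x i → Dia L y i)
    (hbif : ∀ x y i j, Bif L x i j → Bif L y i j) (w : W) : ∃ T, IsFragment L w T := by
  obtain ⟨F, hF, hw, hle, hd, hb⟩ := exists_finite_witnesses L w
  exact ⟨F, hF, hw, hle, hd, hb,
    fun x _ ⟨z, hz, hxz⟩ i hi => .inr ⟨z, hz, hxz, hdia x z i hi⟩,
    fun x _ ⟨z, hz, hxz⟩ i j hij => .inl ⟨z, hz, hxz, hbif x z i j hij⟩⟩

theorem exists_covBy_le_of_finite_Iic {x y : W} (hfin : (Set.Iic y).Finite) (h : x < y) :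
    ∃ c, x ⋖ c ∧ c ≤ y := by
  obtain ⟨c, hcy, hc⟩ := (hfin.subset (s := Set.Iic y) (t := {z | x < z ∧ z ≤ y})
    fun z hz => hz.2).exists_le_minimal ⟨h, le_rfl⟩
  exact ⟨c, ⟨hc.prop.1, fun d hxd hdc => hdc.not_ge (hc.le_of_le ⟨hxd, hdc.le.trans hcy⟩ hdc.le)⟩,
    hcy⟩

/-- Every world strictly above `x` lies above an immediate successor of `x`. The two witnesses of a
`Bif` lie above distinct successors, or above the same one, which then inherits the `Bif`. -/
theorem exists_finite_successors [Finite I] (hfin : ∀ w : W, (Set.Iic w).Finite)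
    (L : I → W → Prop) (x : W) :
    ∃ C : Set W, C.Finite ∧ C ⊆ {c | x ⋖ c} ∧ (∀ i, Dia L x i → L i x ∨ ∃ c ∈ C, Dia L c i) ∧
      ∀ i j, Bif L x i j →
        (∃ c ∈ C, Bif L c i j) ∨ ∃ c ∈ C, ∃ d ∈ C, c ≠ d ∧ Dia L c i ∧ Dia L d j := by
  obtain ⟨F, hF, hFx, hdia⟩ := exists_finite_forall_of_mono (S := {c | x ⋖ c})
    (P := fun i C => Dia L x i → L i x ∨ ∃ c ∈ C, Dia L c i)
    (fun i C D hCD h hi => (h hi).imp id fun ⟨y, hy⟩ => ⟨y, hCD hy.1, hy.2⟩) (fun i => by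
      by_cases h : ∃ y, x < y ∧ L i y
      · obtain ⟨y, hy, hi⟩ := h
        obtain ⟨c, hc, hcy⟩ := exists_covBy_le_of_finite_Iic (hfin y) hy
        exact ⟨{c}, Set.finite_singleton c, by simpa using hc,
          fun _ => .inr ⟨c, rfl, y, hcy, hi⟩⟩
      · refine ⟨∅, Set.finite_empty, Set.empty_subset _, fun ⟨y, hy, hi⟩ => .inl ?_⟩
        rcases hy.eq_or_lt with rfl | hlt
        · exact hi
        · exact absurd ⟨y, hlt, hi⟩ h)
  obtain ⟨G, hG, hGx, hbif⟩ := exists_finite_forall_of_mono (S := {c | x ⋖ c})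
    (P := fun (p : I × I) C => Bif L x p.1 p.2 →
      (∃ c ∈ C, Bif L c p.1 p.2) ∨ ∃ c ∈ C, ∃ d ∈ C, c ≠ d ∧ Dia L c p.1 ∧ Dia L d p.2)
    (fun p C D hCD h hi => (h hi).imp (fun ⟨c, hc, h⟩ => ⟨c, hCD hc, h⟩)
      fun ⟨c, hc, d, hd, h⟩ => ⟨c, hCD hc, d, hCD hd, h⟩) (fun p => by
      by_cases h : Bif L x p.1 p.2
      · obtain ⟨y, z, ⟨hxy, hxz, hyz⟩, hi, hj⟩ := h
        have hxy' : x < y := hxy.lt_of_ne fun heq => hyz.1 (heq ▸ hxz)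
        have hxz' : x < z := hxz.lt_of_ne fun heq => hyz.2 (heq ▸ hxy)
        obtain ⟨c, hc, hcy⟩ := exists_covBy_le_of_finite_Iic (hfin y) hxy'
        obtain ⟨d, hd, hdz⟩ := exists_covBy_le_of_finite_Iic (hfin z) hxz'
        refine ⟨{c, d}, Set.toFinite _, Set.insert_subset hc (Set.singleton_subset_iff.2 hd),
          fun _ => ?_⟩
        by_cases hcd : c = d
        · exact .inl ⟨c, by simp, y, z, ⟨hcy, hcd ▸ hdz, hyz⟩, hi, hj⟩
        · exact .inr ⟨c, by simp, d, by simp, hcd, ⟨y, hcy, hi⟩, ⟨z, hdz, hj⟩⟩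
      · exact ⟨∅, Set.finite_empty, Set.empty_subset _, fun hi => absurd hi h⟩)
  refine ⟨F ∪ G, hF.union hG, Set.union_subset hFx hGx, fun i hi => ?_, fun i j hij => ?_⟩
  · exact (hdia i hi).imp id fun ⟨c, hc, h⟩ => ⟨c, .inl hc, h⟩
  · exact (hbif (i, j) hij).imp (fun ⟨c, hc, h⟩ => ⟨c, .inr hc, h⟩)
      fun ⟨c, hc, d, hd, h⟩ => ⟨c, .inr hc, d, .inr hd, h⟩

theorem exists_fragment_of_finite_Iic [Finite I] (hW : IsTree W)
    (hfin : ∀ w : W, (Set.Iic w).Finite) (L : I → W → Prop) (w : W) :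
    ∃ T, IsFragment L w T := by
  obtain ⟨F, hF, hw, hle, hd, hb⟩ := exists_finite_witnesses L w
  choose C hC hcov hdia hbif using exists_finite_successors hfin L
  let D : Set W := {y | w ≤ y ∧ ∃ t ∈ F, y ≤ t}
  have hD : D.Finite := (hF.biUnion fun t _ => hfin t).subset fun y hy => by
    obtain ⟨-, t, ht, hyt⟩ := hy
    exact Set.mem_biUnion ht hyt
  have hFD : F ⊆ D := fun y hy => ⟨hle hy, y, hy, le_rfl⟩
  have hlow : ∀ {x y : W}, w ≤ x → x ≤ y → y ∈ D → x ∈ D :=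
    fun hx hxy ⟨_, t, ht, hyt⟩ => ⟨hx, t, ht, hxy.trans hyt⟩
  -- Obligations are handled at the points of `D`, through `C`. The added successors outside `D` are
  -- maximal in `T` (`hinner`), so they carry no condition.
  let T : Set W := D ∪ ⋃ x ∈ D, C x
  have hCT : ∀ {x c : W}, x ∈ D → c ∈ C x → c ∈ T := fun hx hc => .inr (Set.mem_biUnion hx hc)
  have hsep : ∀ {x c d : W}, x ⋖ c → x ⋖ d → c ≠ d → Separated c d := by
    intro x c d hc hd hne
    exact ⟨fun h => hd.2 hc.lt (h.lt_of_ne hne), fun h => hc.2 hd.lt (h.lt_of_ne hne.symm)⟩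
  have hinner : ∀ x ∈ T, (∃ z ∈ T, x < z) → x ∈ D := by
    rintro x (hx | hx) ⟨z, hz, hxz⟩
    · exact hx
    · obtain ⟨d, hd, hxd⟩ := Set.mem_iUnion₂.1 hx
      have hwx : w ≤ x := hd.1.trans (hcov d hxd).le
      rcases hz with hz | hz
      · exact hlow hwx hxz.le hz
      · obtain ⟨d', hd', hzd'⟩ := Set.mem_iUnion₂.1 hz
        have hz' : d' ⋖ z := hcov d' hzd'
        -- Predecessors of `z` form a chain. As `z` covers `d'`, the point `x < z` cannot lie
        -- strictly above `d'`, so it lies below `d'` and hence in `D`.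
        rcases hW.le_or_le hxz.le hz'.le with h | h
        · exact hlow hwx h hd'
        · rcases h.eq_or_lt with rfl | hlt
          · exact hd'
          · exact absurd hxz (hz'.2 hlt)
  refine ⟨T, hD.union (hD.biUnion fun x _ => hC x), .inl (hFD hw), ?_, ?_, ?_, ?_, ?_⟩
  · rintro x (hx | hx)
    · exact hx.1
    · obtain ⟨d, hd, hxd⟩ := Set.mem_iUnion₂.1 hx
      exact hd.1.trans (hcov d hxd).le
  · intro i hi
    obtain ⟨y, hy, h⟩ := hd i hi
    exact ⟨y, .inl (hFD hy), h⟩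
  · intro i j hij
    obtain ⟨y, hy, z, hz, h⟩ := hb i j hij
    exact ⟨y, .inl (hFD hy), z, .inl (hFD hz), h⟩
  · intro x hx hx' i hi
    have hxD := hinner x hx hx'
    exact (hdia x i hi).imp id fun ⟨c, hc, h⟩ => ⟨c, hCT hxD hc, (hcov x hc).lt, h⟩
  · intro x hx hx' i j hij
    have hxD := hinner x hx hx'
    rcases hbif x i j hij with ⟨c, hc, h⟩ | ⟨c, hc, d, hd, hne, h⟩
    · exact .inl ⟨c, hCT hxD hc, (hcov x hc).lt, h⟩
    · exact .inr ⟨c, hCT hxD hc, d, hCT hxD hd,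
        ⟨(hcov x hc).le, (hcov x hd).le, hsep (hcov x hc) (hcov x hd) hne⟩, h⟩

theorem exists_constant_above [Finite I] [Nonempty W] (L : I → W → Prop) :
    ∃ w : W, ∀ x, w ≤ x → (∀ i, Dia L x i ↔ Dia L w i) ∧ ∀ i j, Bif L x i j ↔ Bif L w i j := by
  -- `L` itself is left out because it is not monotone. `F` decreases along the order, so it is
  -- constant above a world where its value is minimal.
  let F : W → (I → Prop) × (I → I → Prop) := fun x => (Dia L x, Bif L x)
  obtain ⟨_, ⟨⟨w, rfl⟩, hmin⟩⟩ := (Set.toFinite (Set.range F)).exists_minimal (Set.range_nonempty F)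
  refine ⟨w, fun x hx => ?_⟩
  have hle : F x ≤ F w := ⟨fun i h => h.mono hx, fun i j h => h.mono hx⟩
  have hge : F w ≤ F x := hmin ⟨x, rfl⟩ hle
  exact ⟨fun i => ⟨hle.1 i, hge.1 i⟩, fun i j => ⟨hle.2 i j, hge.2 i j⟩⟩

end FragmentExistence

/-! ### The submodel above a world -/

section Above

variable {Atom : Type v}

theorem Formula.WandFree.of_mem_subformulas {A B : Formula Atom} (hA : A.WandFree)
    (hB : B ∈ A.subformulas) : B.WandFree := by
  induction A with
  | atom p => exact hB ▸ hA
  | neg A ih | box A ih => exact hB.elim (fun h => h ▸ hA) (ih hA)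
  | and A C ihA ihC | star A C ihA ihC =>
    rcases hB with rfl | hB | hB
    · exact hA
    · exact ihA hA.1 hB
    · exact ihC hA.2 hB
  | wand A C => exact hA.elim

/-- The submodel of the worlds above `w`. -/
def Model.above (M : Model.{u, v} Atom) (w : M.World) : Model.{u, v} Atom where
  World := Set.Ici w
  order := inferInstance
  isTree :=
    { rooted := ⟨⟨w, le_rfl⟩, fun x => x.2⟩
      persistent := fun a b a' h h' => M.isTree.persistent a.1 b.1 a'.1 h h' }
  val x := M.val x.1

theorem Model.holds_above_iff (M : Model.{u, v} Atom) (w : M.World) (A : Formula Atom)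
    (hA : A.WandFree) (x : (M.above w).World) : (M.above w).Holds x A ↔ M.Holds x.1 A := by
  induction A generalizing x with
  | atom p => rfl
  | neg A ih => exact not_congr (ih hA x)
  | and A B ihA ihB => exact and_congr (ihA hA.1 x) (ihB hA.2 x)
  | box A ih =>
    exact ⟨fun h y hy => (ih hA ⟨y, le_trans x.2 hy⟩).1 (h _ hy), fun h y hy => (ih hA y).2 (h _ hy)⟩
  | star A B ihA ihB =>
    constructor
    · rintro ⟨y, z, hyz, hy, hz⟩
      exact ⟨y.1, z.1, hyz, (ihA hA.1 y).1 hy, (ihB hA.2 z).1 hz⟩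
    · rintro ⟨y, z, hyz, hy, hz⟩
      exact ⟨⟨y, le_trans x.2 hyz.1⟩, ⟨z, le_trans x.2 hyz.2.1⟩, hyz, (ihA hA.1 _).2 hy,
        (ihB hA.2 _).2 hz⟩
  | wand A B => exact hA.elim

theorem Model.literal_above_iff (M : Model.{u, v} Atom) (w : M.World) {φ : Formula Atom}
    (hφ : φ.WandFree) (i : φ.subformulas × Bool) (x : (M.above w).World) :
    (M.above w).literal φ.subformulas i x ↔ M.literal φ.subformulas i x.1 :=
  iff_congr (M.holds_above_iff w _ (hφ.of_mem_subformulas i.1.2) x) Iff.rfl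

theorem Model.dia_above_iff (M : Model.{u, v} Atom) (w : M.World) {φ : Formula Atom}
    (hφ : φ.WandFree) (i : φ.subformulas × Bool) (x : (M.above w).World) :
    Dia ((M.above w).literal φ.subformulas) x i ↔ Dia (M.literal φ.subformulas) x.1 i := by
  constructor
  · rintro ⟨y, hy, h⟩
    exact ⟨y.1, hy, (M.literal_above_iff w hφ i y).1 h⟩
  · rintro ⟨y, hy, h⟩
    exact ⟨⟨y, le_trans x.2 hy⟩, hy, (M.literal_above_iff w hφ i _).2 h⟩

theorem Model.bif_above_iff (M : Model.{u, v} Atom) (w : M.World) {φ : Formula Atom}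
    (hφ : φ.WandFree) (i j : φ.subformulas × Bool) (x : (M.above w).World) :
    Bif ((M.above w).literal φ.subformulas) x i j ↔ Bif (M.literal φ.subformulas) x.1 i j := by
  constructor
  · rintro ⟨y, z, hyz, hy, hz⟩
    exact ⟨y.1, z.1, hyz, (M.literal_above_iff w hφ i y).1 hy, (M.literal_above_iff w hφ j z).1 hz⟩
  · rintro ⟨y, z, hyz, hy, hz⟩
    exact ⟨⟨y, le_trans x.2 hyz.1⟩, ⟨z, le_trans x.2 hyz.2.1⟩, hyz,
      (M.literal_above_iff w hφ i _).2 hy, (M.literal_above_iff w hφ j _).2 hz⟩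

theorem exists_backlinkModel_satisfies (φ : Formula Atom) (hφ : φ.WandFree)
    (h : Satisfiable.{u, v} φ) : ∃ N : BacklinkModel.{v} Atom, N.unfolding.Satisfies φ := by
  obtain ⟨M, hM⟩ := h
  have := φ.finite_subformulas.to_subtype
  have : Nonempty M.World := M.isTree.rooted.nonempty
  obtain ⟨w, hw⟩ := exists_constant_above (M.literal φ.subformulas)
  obtain ⟨N, f, hf, -⟩ := (M.above w).exists_backlinkModel_of_fragments φ hφ
    (exists_fragment_of_constant
      (fun x y i => by
        rw [M.dia_above_iff w hφ, M.dia_above_iff w hφ, (hw x.1 x.2).1, (hw y.1 y.2).1]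
        exact id)
      (fun x y i j => by
        rw [M.bif_above_iff w hφ, M.bif_above_iff w hφ, (hw x.1 x.2).2, (hw y.1 y.2).2]
        exact id))
    ⟨w, le_rfl⟩
  exact ⟨N, fun x => (hf x).2 ((M.holds_above_iff w φ hφ _).2 (hM _))⟩

theorem exists_backlinkModel_holds_root (φ : Formula Atom) (hφ : φ.WandFree)
    (M : Model.{u, v} Atom) (hM : M.FiniteHeights) (w : M.World) (hw : M.Holds w φ) :
    ∃ N : BacklinkModel.{v} Atom, N.unfolding.Holds N.unfoldedRoot φ := by
  have := φ.finite_subformulas.to_subtype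
  obtain ⟨N, f, hf, hroot⟩ := M.exists_backlinkModel_of_fragments φ hφ
    (exists_fragment_of_finite_Iic M.isTree hM _) w
  exact ⟨N, (hf _).2 (hroot.2 hw)⟩

end Above

/-! ### Failure of the finite model property -/

section InfiniteModels

variable {Atom : Type v}

theorem Model.holds_top (M : Model.{u, v} Atom) (w : M.World) (A : Formula Atom) :
    M.Holds w A.top := fun h => h.2 h.1

/-- The nodes of the infinite binary tree. -/
structure BinaryNode : Type u where
  path : List Bool

instance : PartialOrder BinaryNode.{u} where
  le x y := x.path <+: y.path
  le_refl x := List.prefix_refl x.path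
  le_trans _ _ _ h₁ h₂ := List.IsPrefix.trans h₁ h₂
  le_antisymm x y h₁ h₂ := by
    cases x
    cases y
    exact congrArg _ (h₁.eq_of_length (le_antisymm h₁.length_le h₂.length_le))

/-- The infinite binary tree, with the empty valuation. -/
def binaryModel (Atom : Type v) : Model.{u, v} Atom where
  World := BinaryNode
  order := inferInstance
  isTree :=
    { rooted := ⟨⟨[]⟩, fun w => List.nil_prefix (l := w.path)⟩
      persistent := fun a b _ h haa' =>
        ⟨fun h' => h.1 (le_trans haa' h'), fun h' =>
          (List.prefix_or_prefix_of_prefix (l₁ := a.path) (l₂ := b.path) haa' h').elim h.1 h.2⟩ }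
  val _ := ∅

theorem satisfiable_box_star_top (A : Formula Atom) :
    Satisfiable.{u, v} (.box (.star A.top A.top)) := by
  refine ⟨binaryModel Atom, fun _ w _ => ?_⟩
  have hne : ∀ a b : Bool, a ≠ b → ¬ w.path ++ [a] <+: w.path ++ [b] := by
    intro a b hab h
    rw [List.prefix_append_right_inj, List.cons_prefix_cons] at h
    exact hab h.1
  exact ⟨⟨w.path ++ [true]⟩, ⟨w.path ++ [false]⟩,
    ⟨List.prefix_append _ _, List.prefix_append _ _, hne _ _ (by simp), hne _ _ (by simp)⟩,
    Model.holds_top _ _ A, Model.holds_top _ _ A⟩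

/-- Above `w` there is a maximal world; the two futures required there would both equal it. -/
theorem Model.not_holds_box_star_of_finite (M : Model.{u, v} Atom) [Finite M.World] (w : M.World)
    (A B : Formula Atom) : ¬ M.Holds w (.box (.star A B)) := by
  intro h
  obtain ⟨m, hwm, hm⟩ := Finite.exists_le_maximal (p := fun _ : M.World => True) (a := w) trivial
  obtain ⟨x, y, ⟨hx, hy, hxy⟩, -⟩ := h m hwm
  exact hxy.1 ((hm.le_of_ge trivial hx).trans hy)

end InfiniteModels

end BL

theorem mainTheorem4 {Atom : Type v} :
    (∀ φ : BL.Formula Atom, φ.WandFree → BL.Satisfiable.{u, v} φ →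
      ∃ N : BL.BacklinkModel.{v} Atom, N.unfolding.Satisfies φ) ∧
    (∀ φ : BL.Formula Atom, φ.WandFree →
      ∀ M : BL.Model.{u, v} Atom, M.FiniteHeights → ∀ w : M.World, M.Holds w φ →
        ∃ N : BL.BacklinkModel.{v} Atom, N.unfolding.Holds N.unfoldedRoot φ) ∧
    (∀ A : BL.Formula Atom,
      BL.Satisfiable.{u, v} (.box (.star A.top A.top)) ∧
      ∀ M : BL.Model.{u, v} Atom, Finite M.World →
        ∀ w : M.World, ¬ M.Holds w (.box (.star A.top A.top))) :=
  ⟨fun φ hφ h => BL.exists_backlinkModel_satisfies φ hφ h,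
    fun φ hφ M hM w hw => BL.exists_backlinkModel_holds_root φ hφ M hM w hw,
    fun A => ⟨BL.satisfiable_box_star_top A, fun M _ w =>
      M.not_holds_box_star_of_finite w A.top A.top⟩⟩
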